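/- Call a subset of a group normal if it is closed under conjugation (the empty set is allowed). Let $0\le s,t\le 1$ be real numbers. There exist sequences of normal subsets $S_n,T_n\subseteq \mathsf{A}_n$ $(n\ge 3)$ such that $$\lim_{n\to\infty}\frac{|S_n|}{|\mathsf{A}_n|}=s,\qquad \lim_{n\to\infty}\frac{|T_n|}{|\mathsf{A}_n|}=t,$$ and such that for every $n\ge 3$ the product set $S_nT_n=\{xy : x\in S_n,\ y\in T_n\}$ contains no $3$-cycle, if and only if $s+t\le 1$. In particular, the following covering statement is false for the simple alternating groups $\mathsf{A}_n$, $n\ge 5$: "for every $\epsilon>0$ there is $N$ such that, whenever $G$ is one of these groups with $|G|\ge N$ and $S,T\subseteq G$ are normal subsets with $|S|,|T|>\epsilon|G|$, every element of $G\smallsetminus\{e\}$ lies in $ST$." -/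

import Mathlib

open Filter Topology
open scoped Pointwise

/-- A normal subset of a group: a subset closed under conjugation, that is, a (possibly empty)
union of conjugacy classes. -/
def IsNormalSubset {G : Type*} [Group G] (S : Set G) : Prop :=
  ∀ x ∈ S, ∀ g : G, g * x * g⁻¹ ∈ S

/-- The affirmative answer to the covering question for a family `G` of finite groups: for every
constant `ε > 0`, if `|G i|` is sufficiently large and `S`, `T` are normal subsets of `G i` with
more than `ε |G i|` elements each, then every non-identity element of `G i` lies in `S * T`. -/
def CoveringAffirmative {ι : Type*} (G : ι → Type*) [∀ i, Group (G i)] [∀ i, Finite (G i)] :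
    Prop :=
  ∀ ε : ℝ, 0 < ε → ∃ N : ℕ, ∀ i : ι, N ≤ Nat.card (G i) →
    ∀ S T : Set (G i), IsNormalSubset S → IsNormalSubset T →
      ε * (Nat.card (G i) : ℝ) < (S.ncard : ℝ) → ε * (Nat.card (G i) : ℝ) < (T.ncard : ℝ) →
        ∀ g : G i, g ≠ 1 → g ∈ S * T

/-! Multiplying by a 3-cycle raises the number of cycles by at most 2. Let `S` consist of the even
permutations with few cycles and `T` of those with many, the thresholds at least 2 apart: then `S *
T` has no 3-cycle. Quantiles of the cycle count give densities `s` and `t`, and the gap costs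
nothing in the limit because no single cycle count has positive limiting proportion. That follows by
Fourier inversion from `∑ z ^ cycleCount σ = z (z + 1) ⋯ (z + n - 1)`, which is `o(n!)` at
nontrivial roots of unity of odd order. Conversely, `g ∉ S * T` forces `|S| + |T| ≤ |G|`. The
covering statement fails by taking `s = t = 1/2`. -/

/-- The space of rational functions constant along the cycles of a permutation. -/
def invariantFunctions {α : Type*} (σ : Equiv.Perm α) : Submodule ℚ (α → ℚ) where
  carrier := {v | ∀ x, v (σ x) = v x}
  add_mem' := by
    intro v w hv hw x
    simp only [Set.mem_ofPred_eq, Pi.add_apply] at *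
    rw [hv, hw]
  zero_mem' := by intro x; rfl
  smul_mem' := by
    intro c v hv x
    simp only [Set.mem_ofPred_eq, Pi.smul_apply] at *
    rw [hv]

theorem mem_invariantFunctions {α : Type*} {σ : Equiv.Perm α} {v : α → ℚ} :
    v ∈ invariantFunctions σ ↔ ∀ x, v (σ x) = v x := Iff.rfl

/-- The number of cycles of a permutation, fixed points included, expressed as the dimension of
its space of invariant functions. -/
noncomputable def cycleCount {α : Type*} (σ : Equiv.Perm α) : ℕ :=
  Module.finrank ℚ (invariantFunctions σ)

theorem cycleCount_le {n : ℕ} (σ : Equiv.Perm (Fin n)) : cycleCount σ ≤ n := by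
  have h := Submodule.finrank_le (invariantFunctions σ)
  simpa [cycleCount] using h

theorem cycleCount_inv {α : Type*} (σ : Equiv.Perm α) : cycleCount σ⁻¹ = cycleCount σ := by
  have h : invariantFunctions σ⁻¹ = invariantFunctions σ := by
    ext v
    simp only [mem_invariantFunctions]
    constructor
    · intro h x
      have := h (σ x)
      simpa using this.symm
    · intro h x
      have := h (σ⁻¹ x)
      simpa using this.symm
  rw [cycleCount, h, cycleCount]

theorem cycleCount_conj {α : Type*} (g σ : Equiv.Perm α) :
    cycleCount (g * σ * g⁻¹) = cycleCount σ := by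
  have h : (invariantFunctions σ).comap (LinearEquiv.funCongrLeft ℚ ℚ g).toLinearMap =
      invariantFunctions (g * σ * g⁻¹) := by
    ext v
    simp only [Submodule.mem_comap, mem_invariantFunctions, LinearEquiv.coe_coe,
      LinearEquiv.funCongrLeft_apply, LinearMap.funLeft_apply, Equiv.Perm.mul_apply]
    constructor
    · intro h x
      simpa using h (g⁻¹ x)
    · intro h x
      simpa using h (g x)
  rw [cycleCount, ← h, cycleCount, Submodule.comap_equiv_eq_map_symm]
  exact LinearEquiv.finrank_map_eq _ _

/-- Invariant functions of `σ` with `v a = v b` are also invariant under `σ * swap a b`, and this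
one linear condition costs at most one dimension. -/
theorem cycleCount_le_mul_swap_add_one {α : Type*} [Finite α] [DecidableEq α]
    (σ : Equiv.Perm α) (a b : α) :
    cycleCount σ ≤ cycleCount (σ * Equiv.swap a b) + 1 := by
  let φ : invariantFunctions σ →ₗ[ℚ] ℚ :=
    (LinearMap.proj (R := ℚ) (φ := fun _ : α => ℚ) a - LinearMap.proj b) ∘ₗ
      (invariantFunctions σ).subtype
  have h1 := LinearMap.finrank_range_add_finrank_ker φ
  have h2 : Module.finrank ℚ (LinearMap.range φ) ≤ 1 := by
    simpa using Submodule.finrank_le (LinearMap.range φ)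
  have h3 : (LinearMap.ker φ).map (invariantFunctions σ).subtype ≤
      invariantFunctions (σ * Equiv.swap a b) := by
    rintro _ ⟨⟨v, hv⟩, hk, rfl⟩ x
    have hab : v a = v b := by
      have : v a - v b = 0 := hk
      linarith
    change v (σ (Equiv.swap a b x)) = v x
    rw [hv, Equiv.swap_apply_def]
    split_ifs with h h' <;> simp_all
  have h4 := Submodule.finrank_mono h3
  rw [LinearEquiv.finrank_eq
    (Submodule.equivMapOfInjective _ (Submodule.subtype_injective _) _).symm] at h4
  unfold cycleCount
  omega

/-- Two transpositions with product `τ⁻¹` lead from `σ * τ` back to `σ`. -/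
theorem cycleCount_mul_le_of_isThreeCycle {α : Type*} [Fintype α] [DecidableEq α]
    {σ τ : Equiv.Perm α} (hτ : τ.IsThreeCycle) :
    cycleCount (σ * τ) ≤ cycleCount σ + 2 := by
  obtain ⟨a, ha⟩ : τ⁻¹.support.Nonempty := by
    rw [← Finset.card_pos, hτ.inv.card_support]; norm_num
  have h := hτ.inv.eq_swap_mul_swap_iff_mem_support.mpr ha
  have h1 := cycleCount_le_mul_swap_add_one (σ * τ) a (τ⁻¹ a)
  have h2 := cycleCount_le_mul_swap_add_one (σ * τ * Equiv.swap a (τ⁻¹ a)) (τ⁻¹ a) (τ⁻¹ (τ⁻¹ a))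
  rw [mul_assoc (σ * τ), ← h, mul_inv_cancel_right] at h2
  omega

theorem cycleCount_decomposeFin_symm_zero {n : ℕ} (e : Equiv.Perm (Fin n)) :
    cycleCount (Equiv.Perm.decomposeFin.symm (0, e)) = cycleCount e + 1 := by
  let L : (ℚ × invariantFunctions e) ≃ₗ[ℚ]
      invariantFunctions (Equiv.Perm.decomposeFin.symm (0, e)) :=
    { toFun := fun p => ⟨Fin.cons p.1 p.2.1, by
        intro x
        refine Fin.cases ?_ (fun i => ?_) x
        · simp
        · simpa using p.2.2 i⟩
      invFun := fun v => (v.1 0, ⟨Fin.tail v.1, by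
        intro i
        simpa [Fin.tail] using v.2 i.succ⟩)
      left_inv := fun p => by simp
      right_inv := fun v => by simp
      map_add' := fun p q => by
        ext x
        refine Fin.cases ?_ (fun i => ?_) x <;> simp
      map_smul' := fun c q => by
        ext x
        refine Fin.cases ?_ (fun i => ?_) x <;> simp }
  rw [cycleCount, ← L.finrank_eq, Module.finrank_prod, Module.finrank_self, cycleCount, add_comm]

/-- The new point 0 is inserted into the cycle of `p`, so an invariant function extends uniquely, by
its value at `p`. -/
theorem cycleCount_decomposeFin_symm_succ {n : ℕ} (p : Fin n) (e : Equiv.Perm (Fin n)) :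
    cycleCount (Equiv.Perm.decomposeFin.symm (p.succ, e)) = cycleCount e := by
  let L : invariantFunctions e ≃ₗ[ℚ]
      invariantFunctions (Equiv.Perm.decomposeFin.symm (p.succ, e)) :=
    { toFun := fun v => ⟨Fin.cons (v.1 p) v.1, by
        intro x
        refine Fin.cases ?_ (fun i => ?_) x
        · simp
        · have := v.2 i
          rw [Equiv.Perm.decomposeFin_symm_apply_succ, Equiv.swap_apply_def]
          split_ifs with h h' <;> simp_all⟩
      invFun := fun v => ⟨Fin.tail v.1, by
        intro i
        have h0 := v.2 0
        have := v.2 i.succ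
        rw [Equiv.Perm.decomposeFin_symm_apply_zero] at h0
        rw [Equiv.Perm.decomposeFin_symm_apply_succ, Equiv.swap_apply_def] at this
        split_ifs at this with h h' <;> simp_all [Fin.tail]⟩
      left_inv := fun v => by simp
      right_inv := fun v => by
        have h0 := v.2 0
        rw [Equiv.Perm.decomposeFin_symm_apply_zero] at h0
        ext x
        refine Fin.cases ?_ (fun i => ?_) x
        · simpa [Fin.tail] using h0
        · simp [Fin.tail]
      map_add' := fun p q => by
        ext x
        refine Fin.cases ?_ (fun i => ?_) x <;> simp
      map_smul' := fun c q => by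
        ext x
        refine Fin.cases ?_ (fun i => ?_) x <;> simp }
  rw [cycleCount, ← L.finrank_eq, cycleCount]

/-! ### Generating function and anti-concentration of the cycle count -/

theorem sum_pow_cycleCount (n : ℕ) (z : ℂ) :
    ∑ σ : Equiv.Perm (Fin n), z ^ cycleCount σ = ∏ j ∈ Finset.range n, (z + j) := by
  induction n with
  | zero =>
    have h : ∀ σ : Equiv.Perm (Fin 0), cycleCount σ = 0 := fun σ =>
      Nat.le_zero.mp (cycleCount_le σ)
    simp [h]
  | succ n ih =>
    rw [← Equiv.sum_comp Equiv.Perm.decomposeFin.symm, Fintype.sum_prod_type, Fin.sum_univ_succ]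
    simp only [cycleCount_decomposeFin_symm_zero, cycleCount_decomposeFin_symm_succ]
    rw [Finset.sum_const, Finset.card_univ, Fintype.card_fin, Finset.prod_range_succ, ← ih,
      nsmul_eq_mul]
    simp only [pow_succ]
    rw [← Finset.sum_mul]
    ring

/-- By Euler's limit for `Γ(z)`, the quotient has order `n ^ (z.re - 1)`. -/
theorem tendsto_prod_add_div_factorial {z : ℂ} (hre : z.re < 1) (hz : ∀ m : ℕ, z ≠ -m) :
    Tendsto (fun n : ℕ => ‖∏ j ∈ Finset.range n, (z + j)‖ / (n.factorial : ℝ)) atTop (𝓝 0) := by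
  rw [← tendsto_add_atTop_iff_nat 1]
  have hG : Tendsto (fun n => ‖Complex.GammaSeq z n‖⁻¹) atTop (𝓝 ‖Complex.Gamma z‖⁻¹) :=
    (Complex.GammaSeq_tendsto_Gamma z).norm.inv₀ (norm_ne_zero_iff.mpr (Complex.Gamma_ne_zero hz))
  have hp : Tendsto (fun n : ℕ => (n : ℝ) ^ (z.re - 1)) atTop (𝓝 0) := by
    have := (tendsto_rpow_neg_atTop (y := 1 - z.re) (by linarith)).comp
      (tendsto_natCast_atTop_atTop (R := ℝ))
    simpa [Function.comp_def] using this
  have hm := hp.mul hG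
  rw [zero_mul] at hm
  refine squeeze_zero' (Eventually.of_forall fun n => by positivity) ?_ hm
  filter_upwards [eventually_gt_atTop 0] with n hn
  have hn' : (0 : ℝ) < n := by exact_mod_cast hn
  have hprod : 0 < ‖∏ j ∈ Finset.range (n + 1), (z + j)‖ := by
    rw [norm_pos_iff, Finset.prod_ne_zero_iff]
    intro j _ h
    exact hz j (eq_neg_of_add_eq_zero_left h)
  have hfac : (0 : ℝ) < n.factorial := by exact_mod_cast n.factorial_pos
  rw [Complex.GammaSeq, norm_div, norm_mul, Complex.norm_natCast_cpow_of_pos hn,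
    Complex.norm_natCast, Nat.factorial_succ, Real.rpow_sub_one hn'.ne']
  have hpow : 0 < (n : ℝ) ^ z.re := Real.rpow_pos_of_pos hn' _
  rw [inv_div]
  push_cast
  set P := ‖∏ j ∈ Finset.range (n + 1), (z + j)‖
  have : (n : ℝ) ^ z.re / n * (P / ((n : ℝ) ^ z.re * n.factorial)) = P / (n * n.factorial) := by
    field_simp
  rw [this]
  gcongr
  linarith

/-- Fourier inversion on `ℤ / M`, as an upper bound for a single fibre of `f`. -/
theorem mul_card_fiber_le_sum_norm {α : Type*} [Fintype α] (f : α → ℕ) (k : ℕ) {M : ℕ}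
    {ζ : ℂ} (hζ : IsPrimitiveRoot ζ M) (hM : M ≠ 0) :
    (M : ℝ) * (Finset.univ.filter fun a => f a = k).card ≤
      ∑ j ∈ Finset.range M, ‖∑ a, (ζ ^ j) ^ f a‖ := by
  have hnorm : ‖ζ‖ = 1 := hζ.norm'_eq_one hM
  have hζ0 : ζ ≠ 0 := hζ.ne_zero hM
  -- The geometric sum is `M` or 0. It is also `M` when `f a ≡ k` mod `M`, hence only an upper bound
  -- for the fibre.
  have key : ∀ a, ∃ r : ℝ, 0 ≤ r ∧ (f a = k → r = M) ∧
      ∑ j ∈ Finset.range M, ((ζ ^ j) ^ k)⁻¹ * (ζ ^ j) ^ f a = (r : ℂ) := by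
    intro a
    have hterm : ∀ j : ℕ, ((ζ ^ j) ^ k)⁻¹ * (ζ ^ j) ^ f a = ((ζ ^ k)⁻¹ * ζ ^ f a) ^ j := by
      intro j
      rw [mul_pow, inv_pow, ← pow_mul, ← pow_mul, ← pow_mul, ← pow_mul, mul_comm j k,
        mul_comm j (f a)]
    simp only [hterm]
    by_cases h1 : (ζ ^ k)⁻¹ * ζ ^ f a = 1
    · exact ⟨M, by positivity, fun _ => rfl, by simp [h1]⟩
    · refine ⟨0, le_rfl, fun h => ?_, ?_⟩
      · exact absurd (by rw [h, inv_mul_cancel₀ (pow_ne_zero _ hζ0)]) h1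
      · have hpow : ((ζ ^ k)⁻¹ * ζ ^ f a) ^ M = 1 := by
          rw [mul_pow, inv_pow, ← pow_mul, ← pow_mul, mul_comm k, mul_comm (f a), pow_mul, pow_mul,
            hζ.pow_eq_one, one_pow, one_pow, inv_one, one_mul]
        rw [geom_sum_eq h1, hpow]
        simp
  choose r hr0 hrM hr using key
  have hsum : ∑ j ∈ Finset.range M, ((ζ ^ j) ^ k)⁻¹ * ∑ a, (ζ ^ j) ^ f a =
      ((∑ a, r a : ℝ) : ℂ) := by
    simp only [Finset.mul_sum]
    rw [Finset.sum_comm]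
    push_cast
    exact Finset.sum_congr rfl fun a _ => hr a
  calc (M : ℝ) * (Finset.univ.filter fun a => f a = k).card
      = ∑ a ∈ Finset.univ.filter (fun a => f a = k), r a := by
        rw [Finset.sum_congr rfl fun a ha => hrM a (Finset.mem_filter.mp ha).2, Finset.sum_const,
          nsmul_eq_mul, mul_comm]
    _ ≤ ∑ a, r a := Finset.sum_le_sum_of_subset_of_nonneg (Finset.filter_subset _ _)
        fun a _ _ => hr0 a
    _ ≤ ‖((∑ a, r a : ℝ) : ℂ)‖ := by
        rw [Complex.norm_real]; exact le_abs_self _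
    _ ≤ ∑ j ∈ Finset.range M, ‖((ζ ^ j) ^ k)⁻¹ * ∑ a, (ζ ^ j) ^ f a‖ := by
        rw [← hsum]; exact norm_sum_le _ _
    _ = _ := by
        refine Finset.sum_congr rfl fun j _ => ?_
        rw [norm_mul, norm_inv, norm_pow, norm_pow, hnorm, one_pow, one_pow, inv_one, one_mul]

/-- Uniformly in `k`, the proportion of permutations with exactly `k` cycles tends to `0`. -/
theorem eventually_card_cycleCount_eq_le {ε : ℝ} (hε : 0 < ε) :
    ∀ᶠ n : ℕ in atTop, ∀ k : ℕ,
      ((Finset.univ.filter fun σ : Equiv.Perm (Fin n) => cycleCount σ = k).card : ℝ) ≤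
        ε * n.factorial := by
  obtain ⟨m, hm⟩ := exists_nat_gt (1 / ε)
  -- `M > 1/ε` makes the trivial term `n!/M` smaller than `ε n!`; oddness keeps `ζ ^ j` away from
  -- the pole `-1` of `Γ`.
  set M := 2 * m + 1 with hMdef
  have hM : M ≠ 0 := by omega
  have hMpos : (0 : ℝ) < M := by exact_mod_cast Nat.pos_of_ne_zero hM
  have hMε : 1 < M * ε := by
    rw [div_lt_iff₀ hε] at hm
    have : (m : ℝ) * ε ≤ M * ε := by
      gcongr
      omega
    linarith
  have hζ := Complex.isPrimitiveRoot_exp M hM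
  set ζ := Complex.exp (2 * Real.pi * Complex.I / M)
  have hlim : Tendsto (fun n : ℕ => ∑ j ∈ (Finset.range M).erase 0,
      ‖∏ i ∈ Finset.range n, (ζ ^ j + i)‖ / (n.factorial : ℝ)) atTop (𝓝 0) := by
    suffices h : ∀ j ∈ (Finset.range M).erase 0, Tendsto (fun n : ℕ =>
        ‖∏ i ∈ Finset.range n, (ζ ^ j + i)‖ / (n.factorial : ℝ)) atTop (𝓝 0) by
      simpa only [Finset.sum_const_zero] using tendsto_finsetSum _ h
    intro j hj
    obtain ⟨hj0, hjM⟩ := Finset.mem_erase.mp hj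
    rw [Finset.mem_range] at hjM
    have hne : ζ ^ j ≠ 1 := hζ.pow_ne_one_of_pos_of_lt hj0 hjM
    have hnorm : ‖ζ ^ j‖ = 1 := by rw [norm_pow, hζ.norm'_eq_one hM, one_pow]
    refine tendsto_prod_add_div_factorial ?_ ?_
    · refine lt_of_le_of_ne ((Complex.re_le_norm _).trans hnorm.le) fun h => hne ?_
      have h2 := Complex.sq_norm (ζ ^ j)
      rw [hnorm, Complex.normSq_apply, h] at h2
      have him : (ζ ^ j).im = 0 := by
        have : (ζ ^ j).im * (ζ ^ j).im = 0 := by linarith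
        simpa using this
      exact Complex.ext (by simpa using h) (by simpa using him)
    · intro l hl
      have hl1 : (l : ℝ) = 1 := by
        rw [hl, norm_neg, Complex.norm_natCast] at hnorm
        exact hnorm
      have hl1' : l = 1 := by exact_mod_cast hl1
      have hpow : (ζ ^ j) ^ M = 1 := by
        rw [← pow_mul, mul_comm, pow_mul, hζ.pow_eq_one, one_pow]
      rw [hl, hl1', hMdef] at hpow
      norm_num [pow_succ, pow_mul] at hpow
  filter_upwards [hlim.eventually_lt_const (sub_pos.mpr hMε)] with n hn k
  have hfac : (0 : ℝ) < n.factorial := by exact_mod_cast n.factorial_pos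
  have h := mul_card_fiber_le_sum_norm (cycleCount (α := Fin n)) k hζ hM
  simp only [sum_pow_cycleCount] at h
  rw [← Finset.add_sum_erase _ _ (Finset.mem_range.mpr (Nat.pos_of_ne_zero hM))] at h
  rw [← Finset.sum_div, div_lt_iff₀ hfac] at hn
  have h0 : ‖∏ i ∈ Finset.range n, (ζ ^ 0 + (i : ℂ))‖ = n.factorial := by
    rw [← sum_pow_cycleCount]
    simp [Fintype.card_perm]
  rw [h0] at h
  refine le_of_mul_le_mul_left (h.trans ?_) hMpos
  linarith

/-! ### Quantiles of the cycle count on the alternating group -/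

/-- The proportion of even permutations with fewer than `k` cycles. -/
noncomputable def cycleCDF (n k : ℕ) : ℝ :=
  ({σ : alternatingGroup (Fin n) | cycleCount (σ : Equiv.Perm (Fin n)) < k}.ncard : ℝ) /
    (Nat.card (alternatingGroup (Fin n)) : ℝ)

theorem cycleCDF_zero (n : ℕ) : cycleCDF n 0 = 0 := by simp [cycleCDF]

theorem cycleCDF_succ_self (n : ℕ) : cycleCDF n (n + 1) = 1 := by
  have h : {σ : alternatingGroup (Fin n) | cycleCount (σ : Equiv.Perm (Fin n)) < n + 1} =
      Set.univ := by
    ext σ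
    simpa [Nat.lt_succ_iff] using cycleCount_le (σ : Equiv.Perm (Fin n))
  rw [cycleCDF, h, Set.ncard_univ, div_self]
  exact_mod_cast Nat.card_pos.ne'

theorem cycleCDF_mono (n : ℕ) : Monotone (cycleCDF n) := by
  intro a b hab
  unfold cycleCDF
  gcongr
  exact Set.toFinite _

theorem eventually_cycleCDF_succ_le {ε : ℝ} (hε : 0 < ε) :
    ∀ᶠ n : ℕ in atTop, ∀ k : ℕ, cycleCDF n (k + 1) ≤ cycleCDF n k + ε := by
  -- Halving `ε` offsets the index 2 of the alternating group.
  filter_upwards [eventually_card_cycleCount_eq_le (half_pos hε), eventually_ge_atTop 2]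
    with n hn hn2 k
  have : Nontrivial (Fin n) := Fin.nontrivial_iff_two_le.mpr hn2
  have hcard : (2 : ℝ) * Nat.card (alternatingGroup (Fin n)) = n.factorial := by
    have := two_mul_nat_card_alternatingGroup (α := Fin n)
    rw [Nat.card_perm, Nat.card_fin] at this
    exact_mod_cast this
  have hpos : (0 : ℝ) < Nat.card (alternatingGroup (Fin n)) := by exact_mod_cast Nat.card_pos
  have hunion : {σ : alternatingGroup (Fin n) | cycleCount (σ : Equiv.Perm (Fin n)) < k + 1} =
      {σ : alternatingGroup (Fin n) | cycleCount (σ : Equiv.Perm (Fin n)) < k} ∪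
      {σ : alternatingGroup (Fin n) | cycleCount (σ : Equiv.Perm (Fin n)) = k} := by
    ext σ
    simp [le_iff_lt_or_eq]
  have hfib : {σ : alternatingGroup (Fin n) | cycleCount (σ : Equiv.Perm (Fin n)) = k}.ncard ≤
      (Finset.univ.filter fun σ : Equiv.Perm (Fin n) => cycleCount σ = k).card := by
    rw [← Set.ncard_coe_finset]
    refine Set.ncard_le_ncard_of_injOn Subtype.val (fun σ hσ => ?_)
      Subtype.val_injective.injOn (Set.toFinite _)
    simpa using hσ
  have hle : ({σ : alternatingGroup (Fin n) |
        cycleCount (σ : Equiv.Perm (Fin n)) < k + 1}.ncard : ℝ) ≤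
      {σ : alternatingGroup (Fin n) | cycleCount (σ : Equiv.Perm (Fin n)) < k}.ncard +
        ε * Nat.card (alternatingGroup (Fin n)) := by
    have h1 := Set.ncard_union_le
      {σ : alternatingGroup (Fin n) | cycleCount (σ : Equiv.Perm (Fin n)) < k}
      {σ : alternatingGroup (Fin n) | cycleCount (σ : Equiv.Perm (Fin n)) = k}
    rw [← hunion] at h1
    have h2 := (Nat.cast_le (α := ℝ)).mpr (h1.trans (Nat.add_le_add_left hfib _))
    push_cast at h2
    have h3 := hn k
    rw [← hcard] at h3
    linarith
  rw [cycleCDF, cycleCDF, ← sub_le_iff_le_add', ← sub_div, div_le_iff₀ hpos]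
  linarith

open Classical in
/-- The largest number of cycles at which `cycleCDF` does not exceed `s`. -/
noncomputable def cycleQuantile (s : ℝ) (n : ℕ) : ℕ :=
  Nat.findGreatest (fun k => cycleCDF n k ≤ s) (n + 1)

theorem cycleQuantile_mono {s t : ℝ} (h : s ≤ t) (n : ℕ) :
    cycleQuantile s n ≤ cycleQuantile t n :=
  Nat.findGreatest_mono (fun _ hk => le_trans hk h) le_rfl

theorem cycleCDF_cycleQuantile_le {s : ℝ} (hs : 0 ≤ s) (n : ℕ) :
    cycleCDF n (cycleQuantile s n) ≤ s := by
  classical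
  exact Nat.findGreatest_spec (P := fun k => cycleCDF n k ≤ s) (Nat.zero_le _)
    ((cycleCDF_zero n).trans_le hs)

theorem le_cycleCDF_cycleQuantile_succ {s : ℝ} (hs : s ≤ 1) (n : ℕ) :
    s ≤ cycleCDF n (cycleQuantile s n + 1) := by
  classical
  rcases (Nat.findGreatest_le (P := fun k => cycleCDF n k ≤ s) (n + 1)).lt_or_eq with h | h
  · exact (not_le.mp (Nat.findGreatest_is_greatest (P := fun k => cycleCDF n k ≤ s)
      (Nat.lt_succ_self _) h)).le
  · have h' : cycleQuantile s n = n + 1 := h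
    rw [h']
    exact hs.trans ((cycleCDF_succ_self n).symm.trans_le (cycleCDF_mono n (Nat.le_succ _)))

theorem tendsto_cycleCDF_cycleQuantile_add {s : ℝ} (hs0 : 0 ≤ s) (hs1 : s ≤ 1) (d : ℕ) :
    Tendsto (fun n => cycleCDF n (cycleQuantile s n + d)) atTop (𝓝 s) := by
  have hstep : ∀ ε : ℝ, 0 < ε → ∀ᶠ n : ℕ in atTop, ∀ k d : ℕ,
      cycleCDF n (k + d) ≤ cycleCDF n k + d * ε := by
    intro ε hε
    filter_upwards [eventually_cycleCDF_succ_le hε] with n hn k d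
    induction d with
    | zero => simp
    | succ d ih =>
      have := hn (k + d)
      push_cast
      rw [← add_assoc]
      linarith
  rw [Metric.tendsto_atTop']
  intro ε hε
  -- With this step size, both `d` steps (upper bound) and one step (lower bound) total less than
  -- `ε`, even for `d = 0`.
  obtain ⟨N, hN⟩ := eventually_atTop.mp (hstep (ε / (d + 2)) (by positivity))
  refine ⟨N, fun n hn => ?_⟩
  have hd : (d : ℝ) * (ε / (d + 2)) < ε := by
    rw [mul_div_assoc', div_lt_iff₀ (by positivity)]
    linarith
  have h1' : ε / (d + 2) < ε := by
    rw [div_lt_iff₀ (by positivity)]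
    have : 0 ≤ ε * d := by positivity
    linarith
  have h1 := hN n hn.le (cycleQuantile s n) d
  have h2 := hN n hn.le (cycleQuantile s n) 1
  have h3 := cycleCDF_cycleQuantile_le hs0 n
  have h4 := le_cycleCDF_cycleQuantile_succ hs1 n
  have h5 := cycleCDF_mono n (Nat.le_add_right (cycleQuantile s n) d)
  rw [Real.dist_eq, abs_lt]
  push_cast at h2
  constructor <;> linarith

/-! ### Construction, counting bound and conclusion -/

theorem exists_normal_subsets_mul_without_threeCycle {s t : ℝ} (hs0 : 0 ≤ s) (hs1 : s ≤ 1)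
    (ht0 : 0 ≤ t) (ht1 : t ≤ 1) (hst : s + t ≤ 1) :
    ∃ S T : (n : ℕ) → Set (alternatingGroup (Fin n)),
      (∀ n, IsNormalSubset (S n) ∧ IsNormalSubset (T n)) ∧
      Tendsto (fun n : ℕ =>
        ((S n).ncard : ℝ) / (Nat.card (alternatingGroup (Fin n)) : ℝ)) atTop (𝓝 s) ∧
      Tendsto (fun n : ℕ =>
        ((T n).ncard : ℝ) / (Nat.card (alternatingGroup (Fin n)) : ℝ)) atTop (𝓝 t) ∧
      (∀ n, ∀ g ∈ S n * T n, ¬ (g : Equiv.Perm (Fin n)).IsThreeCycle) := by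
  -- Since `s ≤ 1 - t`, the thresholds are ordered; the shift by 2 is what a 3-cycle can add.
  refine ⟨fun n => {σ | cycleCount (σ : Equiv.Perm (Fin n)) < cycleQuantile s n},
    fun n => {σ | cycleCount (σ : Equiv.Perm (Fin n)) < cycleQuantile (1 - t) n + 2}ᶜ,
    fun n => ⟨?_, ?_⟩, tendsto_cycleCDF_cycleQuantile_add hs0 hs1 0, ?_, ?_⟩
  · intro x hx g
    have : cycleCount (x : Equiv.Perm (Fin n)) < cycleQuantile s n := hx
    simpa [cycleCount_conj] using this
  · intro x hx g
    have : ¬ cycleCount (x : Equiv.Perm (Fin n)) < cycleQuantile (1 - t) n + 2 := hx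
    simpa [cycleCount_conj] using this
  · have h := (tendsto_cycleCDF_cycleQuantile_add (s := 1 - t) (by linarith) (by linarith)
      2).const_sub 1
    rw [sub_sub_cancel] at h
    refine h.congr fun n => ?_
    have hpos : (0 : ℝ) < Nat.card (alternatingGroup (Fin n)) := by exact_mod_cast Nat.card_pos
    rw [cycleCDF, eq_div_iff hpos.ne', sub_mul, div_mul_cancel₀ _ hpos.ne', one_mul,
      sub_eq_iff_eq_add', ← Nat.cast_add, Set.ncard_add_ncard_compl]
  · rintro n _ ⟨x, hx, y, hy, rfl⟩ h3
    have hx' : cycleCount (x : Equiv.Perm (Fin n)) < cycleQuantile s n := hx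
    have hy' : ¬ cycleCount (y : Equiv.Perm (Fin n)) < cycleQuantile (1 - t) n + 2 := hy
    have hq : cycleQuantile s n ≤ cycleQuantile (1 - t) n := cycleQuantile_mono (by linarith) n
    have h := cycleCount_mul_le_of_isThreeCycle (σ := (x : Equiv.Perm (Fin n))⁻¹) h3
    simp only [Subgroup.coe_mul, inv_mul_cancel_left, cycleCount_inv] at h
    omega

/-- The injection `x ↦ x⁻¹ * g` sends `S` into the complement of `T`. -/
theorem ncard_add_ncard_le_of_notMem_mul {G : Type*} [Group G] [Finite G] {S T : Set G} {g : G}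
    (h : g ∉ S * T) : S.ncard + T.ncard ≤ Nat.card G := by
  have hle : S.ncard ≤ Tᶜ.ncard := by
    refine Set.ncard_le_ncard_of_injOn (fun x => x⁻¹ * g) (fun x hx hT => ?_)
      (fun x _ y _ hxy => by simpa using hxy) (Set.toFinite _)
    exact h ⟨x, hx, _, hT, mul_inv_cancel_left x g⟩
  have := Set.ncard_add_ncard_compl T
  omega

theorem exists_isThreeCycle_mem_alternatingGroup {n : ℕ} (hn : 3 ≤ n) :
    ∃ g : alternatingGroup (Fin n), (g : Equiv.Perm (Fin n)).IsThreeCycle := by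
  have h := Equiv.Perm.isThreeCycle_swap_mul_swap_same
    (a := (⟨0, by omega⟩ : Fin n)) (b := ⟨1, by omega⟩) (c := ⟨2, by omega⟩)
    (by simp) (by simp) (by simp)
  exact ⟨⟨_, h.mem_alternatingGroup⟩, h⟩

theorem le_card_alternatingGroup {n : ℕ} (hn : 3 ≤ n) :
    n ≤ Nat.card (alternatingGroup (Fin n)) := by
  have : Nontrivial (Fin n) := Fin.nontrivial_iff_two_le.mpr (by omega)
  have h := two_mul_nat_card_alternatingGroup (α := Fin n)
  rw [Nat.card_perm, Nat.card_fin] at h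
  obtain ⟨m, rfl⟩ : ∃ m, n = m + 1 := ⟨n - 1, by omega⟩
  have h2 : 2 ≤ m.factorial := (by omega : 2 ≤ m).trans m.self_le_factorial
  rw [Nat.factorial_succ] at h
  nlinarith

theorem mainTheorem6 :
    (∀ s t : ℝ, 0 ≤ s → s ≤ 1 → 0 ≤ t → t ≤ 1 →
      ((∃ S T : (n : ℕ) → Set (alternatingGroup (Fin n)),
          (∀ n : ℕ, 3 ≤ n → IsNormalSubset (S n) ∧ IsNormalSubset (T n)) ∧
          Tendsto (fun n : ℕ =>
            ((S n).ncard : ℝ) / (Nat.card (alternatingGroup (Fin n)) : ℝ)) atTop (𝓝 s) ∧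
          Tendsto (fun n : ℕ =>
            ((T n).ncard : ℝ) / (Nat.card (alternatingGroup (Fin n)) : ℝ)) atTop (𝓝 t) ∧
          (∀ n : ℕ, 3 ≤ n → ∀ g ∈ S n * T n,
            ¬ (g : Equiv.Perm (Fin n)).IsThreeCycle)) ↔
        s + t ≤ 1)) ∧
    ¬ CoveringAffirmative
        (fun n : {n : ℕ // 5 ≤ n} => (alternatingGroup (Fin (n : ℕ)) : Type)) := by
  refine ⟨fun s t hs0 hs1 ht0 ht1 => ⟨?_, fun hst => ?_⟩, fun hcov => ?_⟩
  · rintro ⟨S, T, -, hS, hT, h3⟩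
    refine le_of_tendsto (hS.add hT) ?_
    filter_upwards [eventually_ge_atTop 3] with n hn
    obtain ⟨g, hg⟩ := exists_isThreeCycle_mem_alternatingGroup hn
    have hpos : (0 : ℝ) < Nat.card (alternatingGroup (Fin n)) := by exact_mod_cast Nat.card_pos
    rw [← add_div, div_le_one hpos]
    exact_mod_cast ncard_add_ncard_le_of_notMem_mul fun hm => h3 n hn g hm hg
  · obtain ⟨S, T, hN, hS, hT, h3⟩ :=
      exists_normal_subsets_mul_without_threeCycle hs0 hs1 ht0 ht1 hst
    exact ⟨S, T, fun n _ => hN n, hS, hT, fun n _ => h3 n⟩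
  · obtain ⟨S, T, hN, hS, hT, h3⟩ := exists_normal_subsets_mul_without_threeCycle
      (s := 1 / 2) (t := 1 / 2) (by norm_num) (by norm_num) (by norm_num) (by norm_num)
      (by norm_num)
    obtain ⟨N, hcov⟩ := hcov (1 / 4) (by norm_num)
    obtain ⟨n, hSn, hTn, hn5, hnN⟩ :=
      ((hS.eventually_const_lt (by norm_num : (1 / 4 : ℝ) < 1 / 2)).and
      ((hT.eventually_const_lt (by norm_num : (1 / 4 : ℝ) < 1 / 2)).and
        ((eventually_ge_atTop 5).and (eventually_ge_atTop N)))).exists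
    obtain ⟨g, hg⟩ := exists_isThreeCycle_mem_alternatingGroup (n := n) (by omega)
    have hpos : (0 : ℝ) < Nat.card (alternatingGroup (Fin n)) := by exact_mod_cast Nat.card_pos
    rw [lt_div_iff₀ hpos] at hSn hTn
    refine h3 n g (hcov ⟨n, hn5⟩ (hnN.trans (le_card_alternatingGroup (by omega))) (S n) (T n)
      (hN n).1 (hN n).2 hSn hTn g fun h1 => hg.ne_one ?_) hg
    rw [h1, Subgroup.coe_one]
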